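/- **Types and the Markov process.** A type is a word of length two in the letters $n,s$. Types are multiplied letter by letter, where $ss=nn=s$ and $sn=ns=n$ for single letters, and $f(t_1t_2)=t_2t_1$. A factor $[T,d]$ consists of a type $T$ and a degree $d\ge 1$; a factorization type is a finite formal product (multiset) of factors. A factor has the following children. If $T$ starts with $n$, then $[T,d]\to[f(T),2d]$. If $T$ starts with $s$, then $[T,d]\to[T_1,d][T_2,d]$, where all pairs of types $(T_1,T_2)$ with $T_1T_2=f(T)$ whose second letters agree are equally probable. Explicitly, $[nn,d]\to[nn,2d]$; $[ns,d]\to[sn,2d]$; $[sn,d]\to[ns,d][ss,d]$ or $[nn,d][sn,d]$, each with probability $\frac12$; $[ss,d]\to[T',d][T',d]$ for $T'\in\{nn,ns,sn,ss\}$, each with probability $\frac14$. Different factors have their children independently. **Model 5.** (This model comes from factoring the polynomials $h_a(x)=(x+a)^2-a-1$, $a\in\mathbb Z$, $a\neq\pm b^2$, modulo primes $\equiv1\pmod 4$; their critical point $-a$ is periodic with post-critical orbit $\{-a-1,-a\}$.) The level $1$ data is the probability distribution $$([nn,2],\tfrac14),\ ([sn,2],\tfrac14),\ ([nn,1][sn,1],\tfrac18),\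 ([ns,1][ss,1],\tfrac18),$$ $$([nn,1][nn,1],\tfrac1{16}),\ ([ns,1][ns,1],\tfrac1{16}),\ ([sn,1][sn,1],\tfrac1{16}),\ ([ss,1][ss,1],\tfrac1{16}),$$ and the level $n$ data is the distribution obtained from it by applying the Markov process $n-1$ times. The level $n$ cycle data is the induced distribution on multisets of degrees (the types are forgotten). **The groups.** Let $T_n$ be the complete binary rooted tree of height $n$, its leaves numbered $1,\dots,2^n$ from left to right, and $W_n=\mathrm{Aut}(T_n)$, acting on the leaves; for $i<n$, $W_i$ is viewed as the subgroup of $W_n$ acting on the first $2^i$ leaves and fixing the others. Products of permutations are composed from right to left. Put $a_j=(1,2^{j-1}+1)(2,2^{j-1}+2)\cdots(2^{j-1},2^j)$, $x_k=a_1a_2\cdots a_k$ and $v_i=x_{i+2}^2$. Let $m_1=\mathrm{id}$ and $m_2=(1,2)\in W_2$, with the type $sn$ attached to its cycle $(1,2)$ and the type $ss$ to each of its fixed points. For $n\ge2$ the permutation $m_{n+1}$, with types attached to its cycles, is obtained from $m_n$ by the Markov map: a cycle $(c_1,\dots,c_k)$ of $m_n$, written with its smallest element first, of a type $T$ is replaced,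 if $T$ starts with $n$, by the cycle $(2c_1-1,\dots,2c_k-1,2c_1,\dots,2c_k)$ with the type $f(T)$, and, if $T$ starts with $s$, by the two cycles $(2c_1-1,\dots,2c_k-1)$ and $(2c_1,\dots,2c_k)$ with the types $nn$ and $sn$ if $T=sn$, and both with the type $ss$ if $T=ss$. For $n\ge1$ let $$M_n=\langle x_n,\ m_n,\ v_{n-3},\dots,v_0\rangle$$ (no $v_i$ if $n\le2$). **Theorem C.** For every $n\ge1$, $M_n$ is a subgroup of $W_n$ that satisfies Model 5: for every multiset $c$ of positive integers, the proportion of the elements of $M_n$ whose cycle type (with cycles of length $1$ included) is $c$ equals the probability of $c$ in the level $n$ cycle data of Model 5. -/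

import Mathlib

namespace PCFMarkov

/-! ### Types and the Markov process -/

/-- A digit of a type: `s` (the value is a square) or `n` (it is not a square). -/
inductive Digit where
  | n : Digit
  | s : Digit
deriving DecidableEq

instance : Fintype Digit where
  elems := {Digit.n, Digit.s}
  complete := fun d => by cases d <;> decide

/-- Digits multiply like values of the quadratic character: `s` is the identity, `n * n = s`. -/
instance : Mul Digit where
  mul
    | .s, e => e
    | d, .s => d
    | .n, .n => .s

/-- A type for a quadratic polynomial whose post-critical orbit is `{f(c), f²(c)}`. -/
abbrev Typ : Type := Digit × Digit

/-- The type `nn`. -/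
def nn : Typ := (Digit.n, Digit.n)
/-- The type `ns`. -/
def ns : Typ := (Digit.n, Digit.s)
/-- The type `sn`. -/
def sn : Typ := (Digit.s, Digit.n)
/-- The type `ss`. -/
def ss : Typ := (Digit.s, Digit.s)

/-- The action of `f` on types when `f³(c) = f(c)`: shift one position to the left and use the
first entry as the new last entry. -/
def Typ.shift (T : Typ) : Typ := (T.2, T.1)

/-- The allowable (ordered) pairs of types `(T₁, T₂)` of the two children of a factor whose type
`T` starts with `s`: the product of the two types is `f(T)`, and, the critical point being
periodic, their last digits agree. -/
def allowable (T : Typ) : Finset (Typ × Typ) :=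
  Finset.univ.filter fun q => q.1 * q.2 = T.shift ∧ q.1.2 = q.2.2

/-- A factorization type `∏ [tᵢ, dᵢ]`: the multiset of the pairs (type, degree). -/
abbrev FactType : Type := Multiset (Typ × ℕ)

/-- A level data: a finite formal sum of factorization types, the coefficient of a factorization
type being its density.  Equal factorization types are merged by adding up their densities; the
product of two such sums joins independent factorization types and multiplies the densities. -/
abbrev Data : Type := AddMonoidAlgebra ℚ FactType

/-- The datum `(F, r)`. -/
noncomputable def datum (F : FactType) (r : ℚ) : Data := AddMonoidAlgebra.single F r

/-- One transition of the process for a single factor `[T, d]`.  If `T` starts with `n`, there is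
one child `[f(T), 2d]`.  If `T` starts with `s`, there are two children `[T₁, d][T₂, d]`, all
allowable pairs `(T₁, T₂)` being equally probable. -/
noncomputable def children (p : Typ × ℕ) : Data :=
  match p.1.1 with
  | .n => datum {(p.1.shift, 2 * p.2)} 1
  | .s => ∑ q ∈ allowable p.1, datum {(q.1, p.2), (q.2, p.2)} (1 / ((allowable p.1).card : ℚ))

/-- The process applied to a level `n` data: the factors of each factorization type have their
children independently of each other. -/
noncomputable def step (D : Data) : Data :=
  D.coeff.sum fun F r => r • (F.map children).prod

/-- The level `n` data (`1 ≤ n`) obtained from the level `1` data `D`. -/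
noncomputable def levelData (D : Data) (n : ℕ) : Data := step^[n - 1] D

/-- The level `n` cycle data obtained from the level `1` data `D`: forget the types and keep the
degrees, adding up the densities that belong to the same multiset of degrees. -/
noncomputable def modelCycleData (D : Data) (n : ℕ) : Multiset ℕ →₀ ℚ :=
  (levelData D n).coeff.mapDomain (Multiset.map Prod.snd)

/-- The level `1` data of Model 5 (the even Markov model of `(x + a)² - a - 1`, `a ≠ ± b²`; its
post-critical orbit is `{-a-1, -a}`, the critical point `-a` being periodic). -/
noncomputable def model5 : Data :=
  datum {(nn, 2)} (1 / 4) + datum {(sn, 2)} (1 / 4) +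
  datum {(nn, 1), (sn, 1)} (1 / 8) + datum {(ns, 1), (ss, 1)} (1 / 8) +
  datum {(nn, 1), (nn, 1)} (1 / 16) + datum {(ns, 1), (ns, 1)} (1 / 16) +
  datum {(sn, 1), (sn, 1)} (1 / 16) + datum {(ss, 1), (ss, 1)} (1 / 16)

/-! ### The tree of height `n`

The leaves of the complete binary rooted tree `Tₙ` are numbered from left to right by
`0, …, 2ⁿ - 1`.  The leaves `i` and `j` lie below the same vertex at distance `k` from the leaves
if and only if `i / 2ᵏ = j / 2ᵏ`.  -/

/-- `Aut(Tₙ)` as a group of permutations of the leaves. -/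
def treeAut (n : ℕ) : Subgroup (Equiv.Perm (Fin (2 ^ n))) where
  carrier := {g | ∀ (k : ℕ) (i j : Fin (2 ^ n)),
    (g i).val / 2 ^ k = (g j).val / 2 ^ k ↔ i.val / 2 ^ k = j.val / 2 ^ k}
  mul_mem' := fun ha hb k i j => (ha k _ _).trans (hb k i j)
  one_mem' := fun _ _ _ => Iff.rfl
  inv_mem' := fun {g} hg k i j => by
    have h := hg k (g⁻¹ i) (g⁻¹ j)
    rw [← Equiv.Perm.mul_apply, ← Equiv.Perm.mul_apply, mul_inv_cancel] at h
    exact h.symm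

/-- The cycle data of `G`: the proportion of the elements of `G` with cycle type `c`, where
cycles of length `1` are counted. -/
noncomputable def cycleProportion {n : ℕ} (G : Subgroup (Equiv.Perm (Fin (2 ^ n))))
    (c : Multiset ℕ) : ℚ :=
  (Nat.card {g : G // (g : Equiv.Perm (Fin (2 ^ n))).partition.parts = c} : ℚ) / Nat.card G

/-- `G` is a group of automorphisms of `Tₙ` whose cycle data match the level `n` cycle data
obtained from the level `1` data `D`. -/
def Satisfies (D : Data) (n : ℕ) (G : Subgroup (Equiv.Perm (Fin (2 ^ n)))) : Prop :=
  G ≤ treeAut n ∧ ∀ c : Multiset ℕ, cycleProportion G c = modelCycleData D n c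

/-! ### The standard generators and odometers -/

/-- The map that exchanges `i` and `i + 2 ^ (j - 1)` for `0 ≤ i < 2 ^ (j - 1)` and fixes all
other numbers. -/
def swapHalves (j i : ℕ) : ℕ :=
  if i < 2 ^ (j - 1) then i + 2 ^ (j - 1)
  else if i < 2 ^ (j - 1) + 2 ^ (j - 1) then i - 2 ^ (j - 1)
  else i

theorem swapHalves_swapHalves (j i : ℕ) : swapHalves j (swapHalves j i) = i := by
  unfold swapHalves
  split_ifs <;> omega

theorem swapHalves_lt {n j i : ℕ} (hj : 1 ≤ j ∧ j ≤ n) (hi : i < 2 ^ n) :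
    swapHalves j i < 2 ^ n := by
  have h : 2 ^ (j - 1) + 2 ^ (j - 1) ≤ 2 ^ n := by
    rw [← two_mul, ← pow_succ', Nat.sub_add_cancel hj.1]
    exact Nat.pow_le_pow_right (by norm_num) hj.2
  unfold swapHalves
  split_ifs <;> omega

/-- The generator `a_j = (1, 2^{j-1}+1)(2, 2^{j-1}+2) ⋯ (2^{j-1}, 2^j)` (leaves numbered
from `1`), as an element of `Wₙ`, for `1 ≤ j ≤ n`.  (Not used for other `j`.) -/
def a (n j : ℕ) : Equiv.Perm (Fin (2 ^ n)) :=
  if hj : 1 ≤ j ∧ j ≤ n then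
    { toFun := fun i => ⟨swapHalves j i, swapHalves_lt hj i.isLt⟩
      invFun := fun i => ⟨swapHalves j i, swapHalves_lt hj i.isLt⟩
      left_inv := fun i => Fin.ext (swapHalves_swapHalves j i)
      right_inv := fun i => Fin.ext (swapHalves_swapHalves j i) }
  else 1

/-- `x_k = a_1 a_2 ⋯ a_k`, the standard `k`-odometer, as an element of `Wₙ` for `k ≤ n`.
Products are composed from right to left. -/
def x (n : ℕ) : ℕ → Equiv.Perm (Fin (2 ^ n))
  | 0 => 1
  | k + 1 => x n k * a n (k + 1)

/-- `v_i = x_{i+2}²`, as an element of `Wₙ` for `i + 2 ≤ n`. -/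
def v (n i : ℕ) : Equiv.Perm (Fin (2 ^ n)) := x n (i + 2) ^ 2

/-! ### The Markov map -/

/-- An element of `Wₙ` together with a formal type attached to each of its cycles. -/
structure TypedPerm (n : ℕ) where
  /-- the permutation of the leaves -/
  perm : Equiv.Perm (Fin (2 ^ n))
  /-- the type of the cycle through a given leaf -/
  type : Fin (2 ^ n) → Typ
  /-- the type depends only on the cycle -/
  type_perm : ∀ i, type (perm i) = type i

/-- The leaf `i` of `Tₙ` has the children `2i` and `2i + 1` in `Tₙ₊₁`. -/
def childEquiv (n : ℕ) : Fin (2 ^ n) × Fin 2 ≃ Fin (2 ^ (n + 1)) :=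
  finProdFinEquiv.trans (finCongr (pow_succ 2 n).symm)

/-- The formal types of the children in the restricted process: `nn → nn`, `ns → sn`,
`sn → nn, sn` and `ss → ss, ss`.  For a type that starts with `s` the value at `b` is the type of
the `b`-th child; for a type that starts with `n` there is only one child, and the value does not
depend on `b`. -/
def restrictedChild : Typ → Fin 2 → Typ
  | (.n, .n), _ => nn
  | (.n, .s), _ => sn
  | (.s, .n), b => if b = 0 then nn else sn
  | (.s, .s), _ => ss

/-- A leaf at which a sheet change happens: `j` is the smallest element of its cycle, and the type
of this cycle starts with `n`. -/
def TypedPerm.Crossing {n : ℕ} (X : TypedPerm n) (j : Fin (2 ^ n)) : Prop :=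
  (X.type j).1 = Digit.n ∧ ∀ k, X.perm.SameCycle j k → j ≤ k

open Classical in
/-- Doublings and splittings.  Let `(c₁, …, cₖ)` be a cycle, written with its smallest element
first.  If its type starts with `n`, it is replaced by the standard doubling
`(2c₁-1, …, 2cₖ-1, 2c₁, …, 2cₖ)`; if its type starts with `s`, by the standard splitting
`(2c₁-1, …, 2cₖ-1)(2c₁, …, 2cₖ)`  (leaves numbered from `1`). -/
noncomputable def TypedPerm.liftPerm {n : ℕ} (X : TypedPerm n) :
    Equiv.Perm (Fin (2 ^ (n + 1))) :=
  (childEquiv n).permCongr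
    (Equiv.prodShear X.perm fun i => if X.Crossing (X.perm i) then Equiv.swap 0 1 else 1)

/-- The types attached to the cycles of the doublings and splittings. -/
def TypedPerm.liftType {n : ℕ} (X : TypedPerm n) (l : Fin (2 ^ (n + 1))) : Typ :=
  restrictedChild (X.type ((childEquiv n).symm l).1) ((childEquiv n).symm l).2

theorem restrictedChild_const {T : Typ} (h : T.1 = Digit.n) (b b' : Fin 2) :
    restrictedChild T b = restrictedChild T b' := by
  obtain ⟨d, e⟩ := T
  subst h
  cases e <;> rfl

/-- The Markov map of level `n`. -/
noncomputable def markovMap {n : ℕ} (X : TypedPerm n) : TypedPerm (n + 1) where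
  perm := X.liftPerm
  type := X.liftType
  type_perm := fun l => by
    obtain ⟨⟨i, b⟩, rfl⟩ := (childEquiv n).surjective l
    simp only [TypedPerm.liftType, TypedPerm.liftPerm, Equiv.permCongr_apply,
      Equiv.symm_apply_apply, Equiv.prodShear_apply, X.type_perm]
    split_ifs with h
    · exact restrictedChild_const ((X.type_perm i) ▸ h.1) _ _
    · rfl

/-! ### The groups `Mₙ` -/

theorem a_two_one (i : Fin (2 ^ 2)) : ((a 2 1 i).val < 2) ↔ i.val < 2 := by
  revert i
  decide

/-- `(1, 2) ∈ W₂` with the type `[sn,2][ss,1]²`. -/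
def mTypedTwo : TypedPerm 2 where
  perm := a 2 1
  type := fun i => if i.val < 2 then sn else ss
  type_perm := fun i => by simp only [a_two_one]

/-- The result of applying the Markov map `k` times to `(1, 2) ∈ W₂`. -/
noncomputable def mTyped : (k : ℕ) → TypedPerm (k + 2)
  | 0 => mTypedTwo
  | k + 1 => markovMap (mTyped k)

/-- `m₁ = id`, and `mₙ` for `2 ≤ n` is obtained from `m₂ = (1, 2)` by successive application of
the Markov map.  (The value at `0` is not used.) -/
noncomputable def m : (n : ℕ) → Equiv.Perm (Fin (2 ^ n))
  | 0 => 1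
  | 1 => 1
  | k + 2 => (mTyped k).perm

/-- `Mₙ = ⟨xₙ, mₙ, v_{n-3}, …, v_0⟩`. -/
noncomputable def M (n : ℕ) : Subgroup (Equiv.Perm (Fin (2 ^ n))) :=
  Subgroup.closure ({x n n, m n} ∪ {g | ∃ i, i + 3 ≤ n ∧ g = v n i})

end PCFMarkov

/-!
Attach a type to every leaf of the tree, and to every other vertex the shift `f` of the product of
the types at its two children. Such a family acts on the tree, exchanging the two subtrees of a
vertex if and only if the type there begins with `n`, and these families form a group whose root
type is multiplicative.

An element of root type `T` restricts to arbitrary families `u` and `v` on the two subtrees with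
`f (typ u * typ v) = T`. If `T` begins with `s`, its cycles are those of `u` and of `v`, and the
pair of types of `u` and `v` is uniformly distributed among the allowable ones; if `T` begins with
`n`, its cycles are those of `u * v` with doubled lengths, and `u * v` is uniformly distributed
among the elements of type `f T`. This is the Markov process, started from a single factor of
degree `1` with a uniformly distributed type, and `model5` is one step away from that start. So
the image of the group in `W n` satisfies Model 5.

The image is `M n`. The odometer, whose only nontrivial leaf type is `nn` at the first leaf, acts
as `x n n`, the squares of the odometers of the left subtrees act as the `v n i`, and `m n` is the
action of the family that has the type of each cycle at the smallest element of the cycle. On all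
the odometers the product of the two digits of the root type is trivial. In a `2`-group, a
generator may be replaced by any element with the same nontrivial image under a homomorphism that
kills the other generators; hence it suffices that some element of digit product `n` generates the
group together with the odometers, and by induction on `n` an element of the left subtree does.
-/

namespace PCFMarkov

/-! ### Generating sets of `p`-groups -/

section Generation

variable {G : Type*} [Group G]

theorem exists_eq_zpow_mul_of_closure_insert_eq_top {a : G} {S : Set G} {N : Subgroup G}
    [N.Normal] (hS : S ⊆ N) (h : Subgroup.closure (insert a S) = ⊤) (g : G) :
    ∃ z : ℤ, ∃ k ∈ N, g = a ^ z * k := by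
  have hle : Subgroup.closure (insert a S) ≤ Subgroup.zpowers a ⊔ N :=
    (Subgroup.closure_le _).mpr <| Set.insert_subset
      (Subgroup.mem_sup_left (Subgroup.mem_zpowers a))
      fun _ hs => Subgroup.mem_sup_right (hS hs)
  obtain ⟨_, ⟨z, rfl⟩, k, hk, rfl⟩ :=
    Subgroup.mem_sup_of_normal_right.mp (hle (h ▸ Subgroup.mem_top g))
  exact ⟨z, k, hk, rfl⟩

theorem mem_of_zpow_mem_of_not_dvd {p : ℕ} [Fact p.Prime] (hG : IsPGroup p G) {H : Subgroup G}
    {g : G} {z : ℤ} (hz : ¬ (p : ℤ) ∣ z) (h : g ^ z ∈ H) : g ∈ H := by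
  obtain ⟨k, hk⟩ := IsPGroup.iff_orderOf.mp hG g
  have hcoprime : IsCoprime z (p ^ k : ℕ) := by
    rw [Nat.cast_pow]
    exact (((Nat.prime_iff_prime_int.mp Fact.out).coprime_iff_not_dvd.mpr hz).symm).pow_right
  exact (Subgroup.zpowers_le.mpr h)
    (mem_zpowers_zpow_iff.mpr (hk ▸ Int.isCoprime_iff_gcd_eq_one.mp hcoprime))

-- A maximal subgroup that contains `b` and `S` is normal, and plays the role of a hyperplane in
-- the exchange lemma of linear algebra.
theorem closure_insert_eq_top_of_map_eq {p : ℕ} [Fact p.Prime] [Finite G] (hG : IsPGroup p G)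
    {C : Type*} [Group C] (ψ : G →* C) {a b : G} {S : Set G} (hS : S ⊆ ψ.ker) (hab : ψ b = ψ a)
    (ha : ψ a ≠ 1) (h : Subgroup.closure (insert a S) = ⊤) :
    Subgroup.closure (insert b S) = ⊤ := by
  by_contra hb
  obtain ⟨H, hH, hbH⟩ := (eq_top_or_exists_le_coatom _).resolve_left hb
  have hbS := (Subgroup.closure_le _).mp hbH
  have := hG.isNilpotent
  have hnormal : H.Normal :=
    Subgroup.NormalizerCondition.normal_of_coatom H Group.normalizerCondition_of_isNilpotent hH
  obtain ⟨z, k, ⟨hkH, hk⟩, rfl⟩ := exists_eq_zpow_mul_of_closure_insert_eq_top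
    (N := H ⊓ ψ.ker) (fun s hs => ⟨hbS (Or.inr hs), hS hs⟩) h b
  have hdvd : (p : ℤ) ∣ z - 1 := by
    by_contra hz
    refine ha (MonoidHom.mem_ker.mp (mem_of_zpow_mem_of_not_dvd hG (H := ψ.ker) hz ?_))
    rw [map_mul, MonoidHom.mem_ker.mp hk, mul_one, map_zpow] at hab
    rw [MonoidHom.mem_ker, map_zpow, zpow_sub_one, hab, mul_inv_cancel]
  have hz : ¬ (p : ℤ) ∣ z := fun hz =>
    (Nat.prime_iff_prime_int.mp Fact.out).not_dvd_one ((dvd_sub_right hz).mp hdvd)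
  have haH : a ∈ H := mem_of_zpow_mem_of_not_dvd hG hz
    ((H.mul_mem_cancel_right hkH).mp (hbS (Set.mem_insert _ _)))
  exact hH.1 (top_le_iff.mp (h ▸ (Subgroup.closure_le _).mpr
    (Set.insert_subset haH fun s hs => hbS (Or.inr hs))))

end Generation

/-! ### Proportions -/

section Proportion

variable {G H : Type*} [Group G] [Group H]

theorem card_subtype_comp_eq_mul_card_ker {f : G →* H} (hf : Function.Surjective f)
    (P : H → Prop) :
    Nat.card {g // P (f g)} = Nat.card {h // P h} * Nat.card f.ker := by
  rw [← Nat.card_prod]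
  exact Nat.card_congr ((Equiv.sigmaSubtypeFiberEquivSubtype f fun _ => Iff.rfl).symm.trans
    ((Equiv.sigmaCongrRight fun h : Subtype P => f.fiberEquivKerOfSurjective hf h).trans
      (Equiv.sigmaEquivProd _ _)))

theorem card_subtype_comp_div_card [Finite G] {f : G →* H} (hf : Function.Surjective f)
    (P : H → Prop) :
    (Nat.card {g // P (f g)} : ℚ) / Nat.card G = Nat.card {h // P h} / Nat.card H := by
  have hG : Nat.card G = Nat.card H * Nat.card f.ker := by
    rw [← f.ker.index_mul_card, Subgroup.index_ker, MonoidHom.range_eq_top.mpr hf,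
      Subgroup.card_top]
  rw [card_subtype_comp_eq_mul_card_ker hf, hG, Nat.cast_mul, Nat.cast_mul, mul_div_mul_right]
  exact Nat.cast_ne_zero.mpr Nat.card_pos.ne'

end Proportion

/-! ### Cycle types -/

section CycleTypes

open Function

variable {α β : Type*}

theorem minimalPeriod_of_semiconj {f : β → β} {g : α → α} {u : α → β} (hu : Injective u)
    (h : Semiconj u g f) (i : α) : minimalPeriod f (u i) = minimalPeriod g i :=
  minimalPeriod_eq_minimalPeriod_iff.mpr fun k => by
    rw [IsPeriodicPt, IsFixedPt, ← (h.iterate_right k).eq, hu.eq_iff]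
    rfl

theorem minimalPeriod_of_semiconj_iterate_two {f : β → β} {g : α → α} {u : α → β}
    (hu : Injective u) (h : Semiconj u g f^[2]) {i : α} (heven : 2 ∣ minimalPeriod f (u i)) :
    minimalPeriod f (u i) = 2 * minimalPeriod g i := by
  rw [← minimalPeriod_of_semiconj hu h, minimalPeriod_iterate_eq_div_gcd two_ne_zero,
    Nat.gcd_eq_right heven, Nat.mul_div_cancel' heven]

variable [Fintype α] [DecidableEq α]

theorem minimalPeriod_eq_card_support_cycleOf (σ : Equiv.Perm α) {i : α} (hi : σ i ≠ i) :
    minimalPeriod σ i = (σ.cycleOf i).support.card := by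
  refine Nat.dvd_right_iff_eq.mp fun k => ?_
  rw [← isPeriodicPt_iff_minimalPeriod_dvd, IsPeriodicPt, IsFixedPt, Equiv.Perm.iterate_eq_pow,
    ← (Equiv.Perm.isCycle_cycleOf σ hi).orderOf, orderOf_dvd_iff_pow_eq_one,
    (Equiv.Perm.isCycle_cycleOf σ hi).pow_eq_one_iff' (by rwa [Equiv.Perm.cycleOf_apply_self]),
    Equiv.Perm.cycleOf_pow_apply_self]

theorem filter_minimalPeriod_eq_biUnion_support (σ : Equiv.Perm α) {d : ℕ} (hd : d ≠ 1) :
    ({i | minimalPeriod σ i = d} : Finset α) =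
      {c ∈ σ.cycleFactorsFinset | c.support.card = d}.biUnion Equiv.Perm.support := by
  ext i
  simp only [Finset.mem_filter, Finset.mem_univ, true_and, Finset.mem_biUnion]
  constructor
  · intro hi
    have hne : σ i ≠ i := fun h =>
      hd (hi.symm.trans (minimalPeriod_eq_one_iff_isFixedPt.mpr h))
    exact ⟨σ.cycleOf i, ⟨Equiv.Perm.cycleOf_mem_cycleFactorsFinset_iff.mpr
      (Equiv.Perm.mem_support.mpr hne), by rw [← minimalPeriod_eq_card_support_cycleOf σ hne, hi]⟩,
      (Equiv.Perm.mem_support_cycleOf_iff' hne).mpr (Equiv.Perm.SameCycle.refl σ i)⟩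
  · rintro ⟨c, ⟨hc, hcard⟩, hi⟩
    have hne : σ i ≠ i :=
      Equiv.Perm.mem_support.mp (Equiv.Perm.mem_cycleFactorsFinset_support_le hc hi)
    rw [minimalPeriod_eq_card_support_cycleOf σ hne, ← Equiv.Perm.cycle_is_cycleOf hi hc, hcard]

theorem card_filter_minimalPeriod_eq_mul_count_cycleType (σ : Equiv.Perm α) {d : ℕ}
    (hd : d ≠ 1) :
    ({i | minimalPeriod σ i = d} : Finset α).card = d * σ.cycleType.count d := by
  rw [filter_minimalPeriod_eq_biUnion_support σ hd, Finset.card_biUnion,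
    Finset.sum_const_nat (m := d) fun c hc => (Finset.mem_filter.mp hc).2, mul_comm,
    Equiv.Perm.cycleType_def, Multiset.count_map]
  · simp only [comp_apply, eq_comm]
    rfl
  · intro c hc c' hc' hne
    exact (σ.cycleFactorsFinset_pairwise_disjoint (Finset.mem_filter.mp hc).1
      (Finset.mem_filter.mp hc').1 hne).disjoint_support

theorem card_filter_minimalPeriod_eq (σ : Equiv.Perm α) (d : ℕ) :
    ({i | minimalPeriod σ i = d} : Finset α).card = d * σ.partition.parts.count d := by
  rw [Equiv.Perm.parts_partition, Multiset.count_add]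
  obtain rfl | hd := eq_or_ne d 1
  · have hcycle : σ.cycleType.count 1 = 0 :=
      Multiset.count_eq_zero.mpr fun h => (Equiv.Perm.one_lt_of_mem_cycleType h).false
    rw [hcycle, Multiset.count_replicate_self, zero_add, one_mul, ← Finset.card_compl]
    congr 1
    ext i
    rw [Finset.mem_filter_univ, Finset.mem_compl, Equiv.Perm.notMem_support,
      minimalPeriod_eq_one_iff_isFixedPt, IsFixedPt]
  · rw [card_filter_minimalPeriod_eq_mul_count_cycleType σ hd, Multiset.count_replicate,
      if_neg hd.symm, add_zero]

theorem zero_notMem_parts (σ : Equiv.Perm α) : 0 ∉ σ.partition.parts :=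
  fun h => (σ.partition.parts_pos h).false

theorem parts_eq_of_card_filter_minimalPeriod {σ : Equiv.Perm α} {c : Multiset ℕ} (hc : 0 ∉ c)
    (h : ∀ d, ({i | minimalPeriod σ i = d} : Finset α).card = d * c.count d) :
    σ.partition.parts = c := by
  ext d
  obtain rfl | hd := Nat.eq_zero_or_pos d
  · rw [Multiset.count_eq_zero.mpr hc, Multiset.count_eq_zero.mpr (zero_notMem_parts σ)]
  · exact Nat.eq_of_mul_eq_mul_left hd ((card_filter_minimalPeriod_eq σ d).symm.trans (h d))

theorem card_filter_mul_minimalPeriod_eq (σ : Equiv.Perm α) {k : ℕ} (hk : 0 < k) (d : ℕ) :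
    k * ({i | k * minimalPeriod σ i = d} : Finset α).card =
      d * (σ.partition.parts.map (k * ·)).count d := by
  by_cases hd : k ∣ d
  · obtain ⟨d, rfl⟩ := hd
    simp only [Nat.mul_right_inj hk.ne', card_filter_minimalPeriod_eq,
      Multiset.count_map_eq_count' (k * ·) _ (mul_right_injective₀ hk.ne'), mul_assoc]
  · have hmap : d ∉ σ.partition.parts.map (k * ·) := fun h => by
      obtain ⟨e, -, rfl⟩ := Multiset.mem_map.mp h
      exact hd (dvd_mul_right k e)
    rw [Multiset.count_eq_zero.mpr hmap, Finset.filter_false_of_mem]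
    · rfl
    · rintro i - rfl
      exact hd (dvd_mul_right k _)

end CycleTypes

/-! ### Leaf typings -/

instance : CommGroup Digit where
  one := .s
  inv := id
  mul_assoc := by decide
  one_mul := by decide
  mul_one := by decide
  inv_mul_cancel := by decide
  mul_comm := by decide

theorem Digit.mul_self (d : Digit) : d * d = .s := by cases d <;> rfl

theorem Digit.mul_mul_cancel (d e : Digit) : d * (d * e) = e := by
  rw [← mul_assoc, mul_self]; rfl

/-- The endomorphism `f` of the group of types. -/
def shiftHom : Monoid.End Typ where
  toFun := Typ.shift
  map_one' := rfl
  map_mul' _ _ := rfl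

/-- The digit `0` of a binary expansion is `s`, so that the identity digit fixes the leaves. -/
def digitEquiv : Digit ≃ Fin 2 where
  toFun | .s => 0 | .n => 1
  invFun b := if b = 0 then .s else .n
  left_inv := by decide
  right_inv := by decide

/-- The leaves of the tree of height `n + 1` as two copies of those of the tree of height `n`, the
left one marked by `s` and the right one by `n`. -/
def halves (n : ℕ) : Fin (2 ^ n) × Digit ≃ Fin (2 ^ (n + 1)) :=
  (Equiv.prodComm _ _).trans <| (digitEquiv.prodCongr (Equiv.refl _)).trans <|
    finProdFinEquiv.trans (finCongr (pow_succ' 2 n).symm)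

/-- The wreath recursion: the two subtrees of the root are permuted by the right component, and the
leaves that arrive in the subtree `d` by the `d`-th entry of the left component. -/
def wreath (n : ℕ) : Equiv.Perm (Fin (2 ^ n)) ≀ᵣ Digit →* Equiv.Perm (Fin (2 ^ (n + 1))) :=
  (halves n).permCongrHom.toMonoidHom.comp (RegularWreathProduct.toPerm _ _ _)

theorem wreath_halves {n : ℕ} (w : Equiv.Perm (Fin (2 ^ n)) ≀ᵣ Digit) (i : Fin (2 ^ n))
    (d : Digit) :
    wreath n w (halves n (i, d)) = halves n (w.left (w.right * d) i, w.right * d) :=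
  congrArg (fun p => halves n (w • p)) ((halves n).symm_apply_apply (i, d))

/-- A family of types, one for each leaf of the tree of height `n`.  These families form a group
that acts on the tree (`LeafTyping.permHom`), and whose elements carry a type
(`LeafTyping.typHom`), as the Frobenius elements of the model do. -/
@[ext]
structure LeafTyping (n : ℕ) where
  /-- The type at a leaf. -/
  label : Fin (2 ^ n) → Typ

namespace LeafTyping

variable {n : ℕ}

/-- A leaf typing as a bare function. -/
def labelEquiv : LeafTyping n ≃ (Fin (2 ^ n) → Typ) := ⟨label, mk, fun _ => rfl, fun _ => rfl⟩

instance : DecidableEq (LeafTyping n) := labelEquiv.decidableEq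

instance : Fintype (LeafTyping n) := Fintype.ofEquiv _ labelEquiv.symm

theorem card_eq : Fintype.card (LeafTyping n) = 4 ^ 2 ^ n := by
  rw [Fintype.card_congr labelEquiv, Fintype.card_fun, Fintype.card_fin]
  rfl

/-- The type at the root, in closed form; `LeafTyping.typ_succ` is the recursion of the model. -/
def typ (g : LeafTyping n) : Typ := (shiftHom ^ n) (∏ i, g.label i)

/-- The restrictions to the two subtrees of the root. -/
def sections : LeafTyping (n + 1) ≃ (Digit → LeafTyping n) where
  toFun g d := ⟨fun i => g.label (halves n (i, d))⟩
  invFun f := ⟨fun l => (f ((halves n).symm l).2).label ((halves n).symm l).1⟩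
  left_inv g := by ext1; funext l; exact congrArg g.label ((halves n).apply_symm_apply l)
  right_inv f := by funext d; simp only [Equiv.symm_apply_apply]

theorem label_halves (g : LeafTyping (n + 1)) (i : Fin (2 ^ n)) (d : Digit) :
    g.label (halves n (i, d)) = (sections g d).label i := rfl

theorem typ_succ (g : LeafTyping (n + 1)) :
    typ g = (typ (sections g .s) * typ (sections g .n)).shift := by
  have hprod : ∏ l, g.label l =
      (∏ i, (sections g .s).label i) * ∏ i, (sections g .n).label i := by
    rw [← (halves n).prod_comp, Fintype.prod_prod_type_right, mul_comm]
    exact Finset.prod_pair (by decide)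
  rw [typ, hprod, pow_succ', map_mul, typ, typ, ← map_mul, ← map_mul]
  rfl

/-- The digit by which an element acts on the two subtrees of the root. -/
def swap (g : LeafTyping (n + 1)) : Digit := (typ g).1

/-- The action on the leaves. -/
def perm : {n : ℕ} → LeafTyping n → Equiv.Perm (Fin (2 ^ n))
  | 0, _ => 1
  | n + 1, g => wreath n ⟨fun d => perm (sections g d), swap g⟩

theorem perm_succ (g : LeafTyping (n + 1)) :
    perm g = wreath n ⟨fun d => perm (sections g d), swap g⟩ := rfl

theorem perm_halves (g : LeafTyping (n + 1)) (i : Fin (2 ^ n)) (d : Digit) :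
    perm g (halves n (i, d)) = halves n (perm (sections g (swap g * d)) i, swap g * d) :=
  wreath_halves _ _ _

theorem perm_symm_halves (g : LeafTyping (n + 1)) (i : Fin (2 ^ n)) (d : Digit) :
    (perm g).symm (halves n (i, d)) = halves n ((perm (sections g d)).symm i, swap g * d) := by
  rw [Equiv.symm_apply_eq, perm_halves, Digit.mul_mul_cancel, Equiv.apply_symm_apply]

instance : Mul (LeafTyping n) := ⟨fun g h => ⟨fun i => g.label i * h.label ((perm g).symm i)⟩⟩

theorem label_mul (g h : LeafTyping n) (i : Fin (2 ^ n)) :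
    (g * h).label i = g.label i * h.label ((perm g).symm i) := rfl

theorem typ_mul (g h : LeafTyping n) : typ (g * h) = typ g * typ h := by
  simp only [typ, label_mul, Finset.prod_mul_distrib, map_mul, Equiv.prod_comp]

theorem swap_mul (g h : LeafTyping (n + 1)) : swap (g * h) = swap g * swap h :=
  congrArg Prod.fst (typ_mul g h)

theorem sections_mul (g h : LeafTyping (n + 1)) (d : Digit) :
    sections (g * h) d = sections g d * sections h (swap g * d) := by
  ext1
  funext i
  rw [← label_halves, label_mul, label_mul, perm_symm_halves, label_halves, label_halves]

theorem perm_mul (g h : LeafTyping n) : perm (g * h) = perm g * perm h := by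
  induction n with
  | zero => rfl
  | succ n ih =>
    simp only [perm_succ, ← map_mul, RegularWreathProduct.mul_def, sections_mul, swap_mul, ih]
    rfl

instance : One (LeafTyping n) := ⟨⟨fun _ => 1⟩⟩

instance : Inv (LeafTyping n) := ⟨fun g => ⟨fun i => (g.label (perm g i))⁻¹⟩⟩

theorem label_one (i : Fin (2 ^ n)) : (1 : LeafTyping n).label i = 1 := rfl

theorem label_inv (g : LeafTyping n) (i : Fin (2 ^ n)) :
    g⁻¹.label i = (g.label (perm g i))⁻¹ := rfl

instance : Group (LeafTyping n) :=
  Group.ofRightAxioms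
    (fun g h k => by
      ext1
      funext i
      simp only [label_mul, perm_mul, Equiv.Perm.mul_def, Equiv.symm_trans_apply, mul_assoc])
    (fun g => by
      ext1
      funext i
      rw [label_mul, label_one, mul_one])
    (fun g => by
      ext1
      funext i
      rw [label_mul, label_inv, Equiv.apply_symm_apply, mul_inv_cancel, label_one])

/-- `LeafTyping.perm` as a homomorphism. -/
def permHom (n : ℕ) : LeafTyping n →* Equiv.Perm (Fin (2 ^ n)) := MonoidHom.mk' perm perm_mul

/-- `LeafTyping.typ` as a homomorphism. -/
def typHom (n : ℕ) : LeafTyping n →* Typ := MonoidHom.mk' typ typ_mul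

end LeafTyping

/-! ### Truncation and the Markov map -/

theorem childEquiv_val {n : ℕ} (i : Fin (2 ^ n)) (b : Fin 2) :
    (childEquiv n (i, b)).val = b.val + 2 * i.val := rfl

theorem childEquiv_val_div_two {n : ℕ} (i : Fin (2 ^ n)) (b : Fin 2) :
    (childEquiv n (i, b)).val / 2 = i.val := by
  rw [childEquiv_val]
  omega

theorem halves_val {n : ℕ} (i : Fin (2 ^ n)) (d : Digit) :
    (halves n (i, d)).val = i.val + 2 ^ n * (digitEquiv d).val := rfl

theorem halves_val_s {n : ℕ} (i : Fin (2 ^ n)) : (halves n (i, .s)).val = i.val := rfl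

theorem halves_val_n {n : ℕ} (i : Fin (2 ^ n)) : (halves n (i, .n)).val = i.val + 2 ^ n :=
  congrArg (i.val + ·) (mul_one (2 ^ n))

theorem childEquiv_halves {n : ℕ} (i : Fin (2 ^ n)) (d : Digit) (b : Fin 2) :
    childEquiv (n + 1) (halves n (i, d), b) = halves (n + 1) (childEquiv n (i, b), d) := by
  ext
  simp only [childEquiv_val, halves_val]
  ring

namespace LeafTyping

variable {n : ℕ}

/-- The type at a leaf of the tree of height `n` is recovered from the types at its two children,
just as `T` is the shift of the product of an allowable pair. -/
def truncate (g : LeafTyping (n + 1)) : LeafTyping n :=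
  ⟨fun i => (g.label (childEquiv n (i, 0)) * g.label (childEquiv n (i, 1))).shift⟩

theorem label_truncate (g : LeafTyping (n + 1)) (i : Fin (2 ^ n)) :
    (truncate g).label i =
      shiftHom (g.label (childEquiv n (i, 0)) * g.label (childEquiv n (i, 1))) := rfl

theorem typ_truncate (g : LeafTyping (n + 1)) : typ (truncate g) = typ g := by
  simp only [typ, label_truncate, ← map_prod, pow_succ, Monoid.End.coe_mul, Function.comp_apply,
    ← (childEquiv n).prod_comp g.label, Fintype.prod_prod_type, Fin.prod_univ_two]

theorem sections_truncate (g : LeafTyping (n + 2)) (d : Digit) :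
    sections (truncate g) d = truncate (sections g d) := by
  ext1
  funext i
  simp only [← label_halves, label_truncate, childEquiv_halves]

theorem perm_childEquiv (g : LeafTyping (n + 1)) (i : Fin (2 ^ n)) (b : Fin 2) :
    perm g (childEquiv n (i, b)) = childEquiv n (perm (truncate g) i,
      if ((truncate g).label (perm (truncate g) i)).1 = .n then Equiv.swap 0 1 b else b) := by
  induction n with
  | zero =>
    obtain ⟨f, rfl⟩ : ∃ f : Fin 2 → Typ, g = ⟨f⟩ := ⟨g.label, rfl⟩
    revert f i b
    decide
  | succ n ih =>
    obtain ⟨⟨i, d⟩, rfl⟩ := (halves n).surjective i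
    have hswap : swap (truncate g) = swap g := congrArg Prod.fst (typ_truncate g)
    rw [childEquiv_halves, perm_halves, ih, perm_halves, hswap, sections_truncate, label_halves,
      sections_truncate, childEquiv_halves]

theorem perm_mem_treeAut (g : LeafTyping n) : perm g ∈ treeAut n := by
  induction n with
  | zero => exact one_mem _
  | succ n ih =>
    intro k l l'
    cases k with
    | zero => simp only [pow_zero, Nat.div_one, Fin.val_inj, EmbeddingLike.apply_eq_iff_eq]
    | succ k =>
      obtain ⟨⟨i, b⟩, rfl⟩ := (childEquiv n).surjective l
      obtain ⟨⟨j, c⟩, rfl⟩ := (childEquiv n).surjective l'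
      simp only [pow_succ', ← Nat.div_div_eq_div_mul, perm_childEquiv, childEquiv_val_div_two]
      exact ih _ k i j

end LeafTyping

namespace TypedPerm

variable {n : ℕ} (X : TypedPerm n)

/-- A leaf that is the smallest one of its cycle. -/
def IsMin (i : Fin (2 ^ n)) : Prop := ∀ k, X.perm.SameCycle i k → i ≤ k

theorem type_eq_of_sameCycle {i k : Fin (2 ^ n)} (h : X.perm.SameCycle i k) :
    X.type k = X.type i := by
  obtain ⟨t, rfl⟩ := h.exists_nat_pow_eq
  induction t with
  | zero => rfl
  | succ t ih => rw [pow_succ', Equiv.Perm.mul_apply, X.type_perm, ih ⟨t, by rw [zpow_natCast]⟩]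

theorem type_markovMap (i : Fin (2 ^ n)) (b : Fin 2) :
    (markovMap X).type (childEquiv n (i, b)) = restrictedChild (X.type i) b :=
  congrArg (fun p : _ × Fin 2 => restrictedChild (X.type p.1) p.2)
    ((childEquiv n).symm_apply_apply (i, b))

open Classical in
theorem perm_markovMap (i : Fin (2 ^ n)) (b : Fin 2) :
    (markovMap X).perm (childEquiv n (i, b)) =
      childEquiv n (X.perm i, if X.Crossing (X.perm i) then Equiv.swap 0 1 b else b) := by
  simp only [markovMap, liftPerm, Equiv.permCongr_apply, Equiv.symm_apply_apply,
    Equiv.prodShear_apply]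
  split_ifs <;> rfl

theorem exists_perm_markovMap_pow (t : ℕ) (i : Fin (2 ^ n)) (b : Fin 2) :
    ∃ c, ((markovMap X).perm ^ t) (childEquiv n (i, b)) = childEquiv n ((X.perm ^ t) i, c) := by
  induction t with
  | zero => exact ⟨b, rfl⟩
  | succ t ih =>
    obtain ⟨c, hc⟩ := ih
    rw [pow_succ' (markovMap X).perm, Equiv.Perm.mul_apply, hc, perm_markovMap,
      pow_succ' X.perm, Equiv.Perm.mul_apply]
    exact ⟨_, rfl⟩

theorem perm_markovMap_pow_of_not_crossing {t : ℕ} {i : Fin (2 ^ n)} (b : Fin 2)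
    (h : ∀ u < t, ¬ X.Crossing ((X.perm ^ (u + 1)) i)) :
    ((markovMap X).perm ^ t) (childEquiv n (i, b)) = childEquiv n ((X.perm ^ t) i, b) := by
  induction t with
  | zero => rfl
  | succ t ih =>
    rw [pow_succ' (markovMap X).perm, Equiv.Perm.mul_apply, ih fun u hu => h u (by omega),
      perm_markovMap, ← Equiv.Perm.mul_apply X.perm, ← pow_succ' X.perm, if_neg (h t (by omega))]

theorem isMin_of_isMin_childEquiv {i : Fin (2 ^ n)} {b : Fin 2}
    (h : (markovMap X).IsMin (childEquiv n (i, b))) : X.IsMin i := by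
  intro k hk
  obtain ⟨t, rfl⟩ := hk.exists_nat_pow_eq
  obtain ⟨c, hc⟩ := X.exists_perm_markovMap_pow t i b
  have hle : childEquiv n (i, b) ≤ childEquiv n ((X.perm ^ t) i, c) :=
    h _ ⟨t, by rw [zpow_natCast, hc]⟩
  rw [Fin.le_def, childEquiv_val, childEquiv_val] at hle
  rw [Fin.le_def]
  omega

theorem not_crossing_of_isMin_childEquiv_one {i : Fin (2 ^ n)}
    (h : (markovMap X).IsMin (childEquiv n (i, 1))) : ¬ X.Crossing i := by
  intro hi
  -- If the orbit of `(i, 1)` did change sheets, it would first do so when it reaches `(i, 0)`.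
  have hpow (t : ℕ) : ¬ X.Crossing ((X.perm ^ (t + 1)) i) := by
    induction t using Nat.strong_induction_on with
    | _ t ih =>
      intro ht
      have hcycle : X.perm.SameCycle i ((X.perm ^ (t + 1)) i) :=
        ⟨(t + 1 : ℕ), by rw [zpow_natCast]⟩
      have hreturn : (X.perm ^ (t + 1)) i = i := le_antisymm (ht.2 _ hcycle.symm) (hi.2 _ hcycle)
      have hsheet : ((markovMap X).perm ^ (t + 1)) (childEquiv n (i, 1)) = childEquiv n (i, 0) := by
        rw [pow_succ' (markovMap X).perm, Equiv.Perm.mul_apply,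
          X.perm_markovMap_pow_of_not_crossing 1 ih, perm_markovMap, ← Equiv.Perm.mul_apply,
          ← pow_succ', hreturn, if_pos hi, Equiv.swap_apply_right]
      have hle : childEquiv n (i, 1) ≤ childEquiv n (i, 0) :=
        h _ ⟨(t + 1 : ℕ), by rw [zpow_natCast, hsheet]⟩
      rw [Fin.le_def, childEquiv_val, childEquiv_val, add_le_add_iff_right] at hle
      exact absurd hle (by decide)
  refine hpow (orderOf X.perm - 1) ?_
  rwa [Nat.sub_add_cancel (orderOf_pos _), pow_orderOf_eq_one]

theorem isMin_childEquiv_zero {i : Fin (2 ^ n)} (h : X.IsMin i) :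
    (markovMap X).IsMin (childEquiv n (i, 0)) := by
  intro l hl
  obtain ⟨t, rfl⟩ := hl.exists_nat_pow_eq
  obtain ⟨c, hc⟩ := X.exists_perm_markovMap_pow t i 0
  have hle := h _ ⟨t, by rw [zpow_natCast]⟩
  rw [Fin.le_def] at hle
  rw [hc, Fin.le_def, childEquiv_val, childEquiv_val, Fin.val_zero]
  omega

theorem isMin_childEquiv_one {i : Fin (2 ^ n)} (h : X.IsMin i) (hs : (X.type i).1 ≠ .n) :
    (markovMap X).IsMin (childEquiv n (i, 1)) := by
  intro l hl
  obtain ⟨t, rfl⟩ := hl.exists_nat_pow_eq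
  have hsheet := X.perm_markovMap_pow_of_not_crossing (t := t) (i := i) 1 fun u _ hu =>
    hs (X.type_eq_of_sameCycle ⟨(u + 1 : ℕ), by rw [zpow_natCast]⟩ ▸ hu.1)
  have hle := h _ ⟨t, by rw [zpow_natCast]⟩
  rw [Fin.le_def] at hle
  rw [hsheet, Fin.le_def, childEquiv_val, childEquiv_val]
  omega

open Classical in
/-- The leaf typing with the type of each cycle at the smallest element of the cycle, and `ss`
elsewhere. -/
noncomputable def leafTyping : LeafTyping n := ⟨fun i => if X.IsMin i then X.type i else ss⟩

open Classical in
theorem label_leafTyping (i : Fin (2 ^ n)) :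
    X.leafTyping.label i = if X.IsMin i then X.type i else ss := rfl

theorem truncate_leafTyping_markovMap : (markovMap X).leafTyping.truncate = X.leafTyping := by
  ext1
  funext i
  rw [LeafTyping.label_truncate]
  simp only [label_leafTyping, type_markovMap]
  by_cases hi : X.IsMin i
  · rw [if_pos hi, if_pos (X.isMin_childEquiv_zero hi)]
    by_cases hn : (X.type i).1 = .n
    · rw [if_neg fun h => X.not_crossing_of_isMin_childEquiv_one h ⟨hn, hi⟩]
      generalize X.type i = T at hn ⊢
      revert T
      decide
    · rw [if_pos (X.isMin_childEquiv_one hi hn)]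
      generalize X.type i = T at hn ⊢
      revert T
      decide
  · rw [if_neg hi, if_neg fun h => hi (X.isMin_of_isMin_childEquiv h),
      if_neg fun h => hi (X.isMin_of_isMin_childEquiv h)]
    rfl

open Classical in
theorem perm_leafTyping_markovMap (h : X.leafTyping.perm = X.perm) :
    (markovMap X).leafTyping.perm = (markovMap X).perm := by
  ext1 l
  obtain ⟨⟨i, b⟩, rfl⟩ := (childEquiv n).surjective l
  have hcross (j : Fin (2 ^ n)) : (X.leafTyping.label j).1 = .n ↔ X.Crossing j := by
    rw [label_leafTyping]
    split_ifs with hj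
    · exact (and_iff_left hj).symm
    · exact iff_of_false (by decide) fun hcr => hj hcr.2
  rw [LeafTyping.perm_childEquiv, truncate_leafTyping_markovMap, h, perm_markovMap,
    if_congr (hcross _) rfl rfl]

end TypedPerm

theorem leafTyping_mTypedTwo :
    mTypedTwo.leafTyping = ⟨fun i => if i = 0 then sn else ss⟩ := by
  have hsame : mTypedTwo.perm.SameCycle 1 0 := ⟨1, by decide⟩
  ext1
  funext i
  rw [TypedPerm.label_leafTyping]
  obtain rfl | rfl | ⟨hpos, htwo⟩ : i = 0 ∨ i = 1 ∨ i ≠ 0 ∧ ¬ i.val < 2 := by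
    revert i
    decide
  · exact if_pos fun k _ => Fin.zero_le k
  · exact if_neg fun hmin => absurd (hmin 0 hsame) (by decide)
  · refine Eq.trans ?_ (if_neg hpos).symm
    split_ifs
    exacts [if_neg htwo, rfl]

theorem perm_leafTyping_mTyped (k : ℕ) : (mTyped k).leafTyping.perm = (mTyped k).perm := by
  induction k with
  | zero =>
    change mTypedTwo.leafTyping.perm = mTypedTwo.perm
    rw [leafTyping_mTypedTwo]
    decide
  | succ k ih => exact (mTyped k).perm_leafTyping_markovMap ih

theorem typ_leafTyping_mTyped (k : ℕ) : (mTyped k).leafTyping.typ = sn := by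
  induction k with
  | zero =>
    change mTypedTwo.leafTyping.typ = sn
    rw [leafTyping_mTypedTwo]
    decide
  | succ k ih =>
    rw [← ih, ← (mTyped k).truncate_leafTyping_markovMap, LeafTyping.typ_truncate]
    rfl

/-! ### Generators of the group of leaf typings -/

namespace LeafTyping

variable {n : ℕ}

theorem typHom_apply (g : LeafTyping n) : typHom n g = typ g := rfl

theorem typ_one : typ (1 : LeafTyping n) = 1 := map_one (typHom n)

/-- The element with the given restrictions to the left and the right subtree of the root. -/
def node (u v : LeafTyping n) : LeafTyping (n + 1) :=
  sections.symm fun | .s => u | .n => v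

theorem sections_node_s (u v : LeafTyping n) : sections (node u v) .s = u := by
  rw [node, Equiv.apply_symm_apply]

theorem sections_node_n (u v : LeafTyping n) : sections (node u v) .n = v := by
  rw [node, Equiv.apply_symm_apply]

theorem node_sections (g : LeafTyping (n + 1)) : node (sections g .s) (sections g .n) = g := by
  refine sections.injective (funext fun d => ?_)
  cases d
  exacts [sections_node_n _ _, sections_node_s _ _]

theorem typ_node (u v : LeafTyping n) : typ (node u v) = (typ u * typ v).shift := by
  rw [typ_succ, sections_node_s, sections_node_n]

theorem swap_node (u v : LeafTyping n) : swap (node u v) = (typ u).2 * (typ v).2 :=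
  congrArg Prod.fst (typ_node u v)

theorem ext_sections {g h : LeafTyping (n + 1)} (hs : sections g .s = sections h .s)
    (hn : sections g .n = sections h .n) : g = h := by
  rw [← node_sections g, hs, hn, node_sections]

theorem node_mul_of_swap_eq_s {u v : LeafTyping n} (h : swap (node u v) = .s)
    (u' v' : LeafTyping n) : node u v * node u' v' = node (u * u') (v * v') := by
  apply ext_sections <;> simp only [sections_mul, h, sections_node_s, sections_node_n]
  exacts [congrArg (u * ·) (sections_node_s _ _), congrArg (v * ·) (sections_node_n _ _)]

theorem node_mul_of_swap_eq_n {u v : LeafTyping n} (h : swap (node u v) = .n)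
    (u' v' : LeafTyping n) : node u v * node u' v' = node (u * v') (v * u') := by
  apply ext_sections <;> simp only [sections_mul, h, sections_node_s, sections_node_n]
  exacts [congrArg (u * ·) (sections_node_n _ _), congrArg (v * ·) (sections_node_s _ _)]

theorem node_one_one : node (1 : LeafTyping n) 1 = 1 := by
  apply ext_sections
  exacts [sections_node_s _ _, sections_node_n _ _]

theorem swap_node_one (u : LeafTyping n) : swap (node u 1) = (typ u).2 := by
  rw [swap_node, typ_one, Prod.snd_one, mul_one]

theorem swap_one_node (v : LeafTyping n) : swap (node 1 v) = (typ v).2 := by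
  rw [swap_node, typ_one, Prod.snd_one, one_mul]

theorem node_one_mul_node_one {u : LeafTyping n} (hu : (typ u).2 = .s) (v : LeafTyping n) :
    node u 1 * node v 1 = node (u * v) 1 := by
  rw [node_mul_of_swap_eq_s ((swap_node_one u).trans hu), mul_one]

theorem node_one_pow_two {x : LeafTyping n} (hx : (typ x).2 = .n) : node x 1 ^ 2 = node x x := by
  rw [sq, node_mul_of_swap_eq_n ((swap_node_one x).trans hx), mul_one, one_mul]

theorem conj_node_left {x u : LeafTyping n} (hx : (typ x).2 = .n) (hu : (typ u).2 = .s) :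
    node x 1 * node u 1 * (node x 1)⁻¹ = node 1 u := by
  rw [mul_inv_eq_iff_eq_mul, node_mul_of_swap_eq_n ((swap_node_one x).trans hx),
    node_mul_of_swap_eq_s ((swap_one_node u).trans hu), mul_one, one_mul, one_mul, mul_one]

theorem conj_node_right {x v : LeafTyping n} (hx : (typ x).2 = .n) (hv : (typ v).2 = .s) :
    node x 1 * node 1 v * (node x 1)⁻¹ = node (x * v * x⁻¹) 1 := by
  have hconj : (typ (x * v * x⁻¹)).2 = .s := by
    rw [← typHom_apply, map_mul, map_mul, map_inv, mul_inv_cancel_comm, typHom_apply, hv]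
  rw [mul_inv_eq_iff_eq_mul, node_mul_of_swap_eq_n ((swap_node_one x).trans hx),
    node_one_mul_node_one hconj, inv_mul_cancel_right, mul_one]

/-- The elements `u` for which `(u, 1)` fixes the subtrees of the root and lies in `G`. -/
def leftSubgroup (G : Subgroup (LeafTyping (n + 1))) : Subgroup (LeafTyping n) where
  carrier := {u | (typ u).2 = .s ∧ node u 1 ∈ G}
  one_mem' := ⟨congrArg Prod.snd typ_one, node_one_one ▸ G.one_mem⟩
  mul_mem' {u v} hu hv := by
    refine ⟨?_, node_one_mul_node_one hu.1 v ▸ G.mul_mem hu.2 hv.2⟩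
    rw [typ_mul, Prod.snd_mul, hu.1, hv.1]
    rfl
  inv_mem' {u} hu := by
    have hinv : (node u 1)⁻¹ = node u⁻¹ 1 := inv_eq_of_mul_eq_one_right <| by
      rw [node_one_mul_node_one hu.1, mul_inv_cancel, node_one_one]
    refine ⟨?_, hinv ▸ G.inv_mem hu.2⟩
    rw [← typHom_apply, map_inv, Prod.snd_inv, typHom_apply, hu.1]
    rfl

section Generators

variable {G : Subgroup (LeafTyping (n + 1))} {x : LeafTyping n} {S : Set (LeafTyping n)}

theorem node_one_left_mem (hx : (typ x).2 = .n) (hxG : node x 1 ∈ G) {u : LeafTyping n}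
    (hu : u ∈ leftSubgroup G) : node 1 u ∈ G := by
  rw [← conj_node_left hx hu.1]
  exact G.mul_mem (G.mul_mem hxG hu.2) (G.inv_mem hxG)

theorem conj_mem_leftSubgroup (hx : (typ x).2 = .n) (hxG : node x 1 ∈ G) {u : LeafTyping n}
    (hu : u ∈ leftSubgroup G) : x * u * x⁻¹ ∈ leftSubgroup G := by
  refine ⟨?_, ?_⟩
  · rw [← typHom_apply, map_mul, map_mul, map_inv, mul_inv_cancel_comm, typHom_apply, hu.1]
  · rw [← conj_node_right hx hu.1]
    exact G.mul_mem (G.mul_mem hxG (node_one_left_mem hx hxG hu)) (G.inv_mem hxG)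

theorem leftSubgroup_normal (hx : (typ x).2 = .n) (hxG : node x 1 ∈ G)
    (hS : S ⊆ leftSubgroup G) (hgen : Subgroup.closure (insert x S) = ⊤) :
    (leftSubgroup G).Normal := by
  rw [← Subgroup.normalizer_eq_top_iff, ← top_le_iff, ← hgen, Subgroup.closure_le]
  exact Set.insert_subset (Subgroup.mem_normalizer_fintype fun u => conj_mem_leftSubgroup hx hxG)
    (hS.trans Subgroup.le_normalizer)

theorem mem_leftSubgroup_iff (hx : (typ x).2 = .n) (hxG : node x 1 ∈ G)
    (hS : S ⊆ leftSubgroup G) (hx2 : x ^ 2 ∈ leftSubgroup G)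
    (hgen : Subgroup.closure (insert x S) = ⊤) {u : LeafTyping n} :
    u ∈ leftSubgroup G ↔ (typ u).2 = .s := by
  refine ⟨And.left, fun hu => ?_⟩
  have := leftSubgroup_normal hx hxG hS hgen
  obtain ⟨z, k, hk, rfl⟩ := exists_eq_zpow_mul_of_closure_insert_eq_top hS hgen u
  have hz : (2 : ℤ) ∣ z := by
    rw [← even_iff_two_dvd, ← Int.not_odd_iff_even]
    rintro ⟨y, rfl⟩
    have hodd : (typ (x ^ (2 * y + 1))).2 = .n := by
      rw [zpow_add_one, zpow_mul, typ_mul, Prod.snd_mul, hx]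
      exact congrArg (· * Digit.n) (zpow_mem hx2 y).1
    rw [typ_mul, Prod.snd_mul, hk.1, hodd] at hu
    exact absurd hu (by decide)
  obtain ⟨y, rfl⟩ := hz
  rw [zpow_mul]
  exact mul_mem (zpow_mem hx2 y) hk

theorem node_mem_of_snd_typ_eq (hx : (typ x).2 = .n) (hxG : node x 1 ∈ G)
    (hS : S ⊆ leftSubgroup G) (hx2 : x ^ 2 ∈ leftSubgroup G)
    (hgen : Subgroup.closure (insert x S) = ⊤) {u v : LeafTyping n} (hu : (typ u).2 = .s)
    (hv : (typ v).2 = .s) : node u v ∈ G := by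
  have hmem {w : LeafTyping n} (hw : (typ w).2 = .s) : w ∈ leftSubgroup G :=
    (mem_leftSubgroup_iff hx hxG hS hx2 hgen).mpr hw
  have hmul := G.mul_mem (hmem hu).2 (node_one_left_mem hx hxG (hmem hv))
  rwa [node_mul_of_swap_eq_s ((swap_node_one u).trans hu), mul_one, one_mul] at hmul

theorem eq_top_of_subset_leftSubgroup (hx : (typ x).2 = .n) (hxG : node x 1 ∈ G)
    (hS : S ⊆ leftSubgroup G) (hx2 : x ^ 2 ∈ leftSubgroup G)
    (hgen : Subgroup.closure (insert x S) = ⊤) : G = ⊤ := by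
  have hfix (g : LeafTyping (n + 1)) (hg : swap g = .s) : g ∈ G := by
    rw [← node_sections g] at hg ⊢
    generalize sections g .s = u, sections g .n = v at hg ⊢
    rw [swap_node] at hg
    cases hu : (typ u).2 <;> cases hv : (typ v).2 <;> rw [hu, hv] at hg
    · have hsquare : node u v = node x 1 ^ 2 * node (x⁻¹ * u) (x⁻¹ * v) := by
        rw [node_one_pow_two hx, node_mul_of_swap_eq_s (by rw [swap_node, Digit.mul_self]),
          mul_inv_cancel_left, mul_inv_cancel_left]
      have hinv {w : LeafTyping n} (hw : (typ w).2 = .n) : (typ (x⁻¹ * w)).2 = .s := by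
        rw [← typHom_apply, map_mul, map_inv, Prod.snd_mul, Prod.snd_inv, typHom_apply,
          typHom_apply, hx, hw]
        rfl
      rw [hsquare]
      exact G.mul_mem (G.pow_mem hxG 2)
        (node_mem_of_snd_typ_eq hx hxG hS hx2 hgen (hinv hu) (hinv hv))
    · exact absurd hg (by decide)
    · exact absurd hg (by decide)
    · exact node_mem_of_snd_typ_eq hx hxG hS hx2 hgen hu hv
  refine (Subgroup.eq_top_iff' G).mpr fun g => ?_
  cases hg : swap g
  · refine (G.mul_mem_cancel_left hxG).mp (hfix _ ?_)
    rw [swap_mul, swap_node_one, hx, hg]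
    rfl
  · exact hfix g hg

end Generators

/-- The odometer: the type `nn` at the first leaf, hence at the root, and `ss` elsewhere. -/
def odometer : (n : ℕ) → LeafTyping n
  | 0 => ⟨fun _ => nn⟩
  | n + 1 => node (odometer n) 1

/-- The squares of the odometers of the leftmost subtrees of positive codimension. -/
def odometerSquares : (n : ℕ) → Set (LeafTyping n)
  | 0 => ∅
  | n + 1 => (fun u => node u 1) '' insert (odometer n ^ 2) (odometerSquares n)

theorem typ_odometer (n : ℕ) : typ (odometer n) = nn := by
  induction n with
  | zero => decide
  | succ n ih => rw [odometer, typ_node, ih, typ_one, mul_one]; rfl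

theorem typ_odometer_sq (n : ℕ) : typ (odometer n ^ 2) = 1 := by
  rw [sq, typ_mul, typ_odometer]
  rfl

theorem typ_eq_one_of_mem_odometerSquares {g : LeafTyping n} (hg : g ∈ odometerSquares n) :
    typ g = 1 := by
  induction n with
  | zero => exact hg.elim
  | succ n ih =>
    obtain ⟨u, hu, rfl⟩ := hg
    have htyp : typ u = 1 := hu.elim (fun h => h ▸ typ_odometer_sq n) ih
    rw [typ_node, htyp, typ_one]
    rfl

theorem exists_typ_eq (T : Typ) : ∃ g : LeafTyping n, typ g = T := by
  induction n generalizing T with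
  | zero => exact ⟨⟨fun _ => T⟩, by revert T; decide⟩
  | succ n ih =>
    obtain ⟨g, hg⟩ := ih T.shift
    exact ⟨node g 1, by rw [typ_node, hg, typ_one, mul_one]; rfl⟩

theorem isPGroup_two : IsPGroup 2 (LeafTyping n) :=
  IsPGroup.of_card (n := 2 * 2 ^ n) <| by rw [Nat.card_eq_fintype_card, card_eq, pow_mul]; rfl

/-- The product of the two digits of the type: it is trivial on the odometer. -/
def digitProd (n : ℕ) : LeafTyping n →* Digit :=
  (MonoidHom.fst Digit Digit * MonoidHom.snd Digit Digit).comp (typHom n)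

theorem digitProd_apply (g : LeafTyping n) : digitProd n g = (typ g).1 * (typ g).2 := rfl

theorem odometers_subset_ker_digitProd :
    insert (odometer n) (odometerSquares n) ⊆ (digitProd n).ker := by
  rintro g (rfl | hg)
  · rw [SetLike.mem_coe, MonoidHom.mem_ker, digitProd_apply, typ_odometer]
    rfl
  · rw [SetLike.mem_coe, MonoidHom.mem_ker, digitProd_apply,
      typ_eq_one_of_mem_odometerSquares hg]
    rfl

theorem closure_insert_odometers_eq_top {g : LeafTyping n} (hg : digitProd n g = .n) :
    Subgroup.closure (insert g (insert (odometer n) (odometerSquares n))) = ⊤ := by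
  induction n with
  | zero =>
    have hcases : ∀ g k : LeafTyping 0, digitProd 0 g = .n →
        k = 1 ∨ k = g ∨ k = odometer 0 ∨ k = g * odometer 0 := by decide
    refine (Subgroup.eq_top_iff' _).mpr fun k => ?_
    have hgmem := Subgroup.subset_closure (Set.mem_insert g (insert (odometer 0) ∅))
    have hxmem := Subgroup.subset_closure
      (Set.mem_insert_of_mem g (Set.mem_insert (odometer 0) ∅))
    obtain rfl | rfl | rfl | rfl := hcases g k hg
    exacts [one_mem _, hgmem, hxmem, mul_mem hgmem hxmem]
  | succ n ih =>
    obtain ⟨p, hp⟩ := exists_typ_eq (n := n) ns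
    have hdigit : digitProd n p = .n := by rw [digitProd_apply, hp]; rfl
    have hdigit' : digitProd (n + 1) (node p 1) = .n := by
      rw [digitProd_apply, typ_node, hp, typ_one]; rfl
    refine closure_insert_eq_top_of_map_eq isPGroup_two (digitProd (n + 1)) (a := node p 1)
      odometers_subset_ker_digitProd (hg.trans hdigit'.symm) (by rw [hdigit']; decide) ?_
    have hx : (typ (odometer n)).2 = .n := by rw [typ_odometer]; rfl
    refine eq_top_of_subset_leftSubgroup (S := insert p (odometerSquares n)) hx
      (Subgroup.subset_closure (.inr (.inl rfl))) ?_ ?_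
      (Set.insert_comm p (odometer n) (odometerSquares n) ▸ ih hdigit)
    · refine Set.insert_subset ⟨by rw [hp]; rfl, Subgroup.subset_closure (Set.mem_insert _ _)⟩
        fun u hu => ⟨?_, Subgroup.subset_closure ?_⟩
      · rw [typ_eq_one_of_mem_odometerSquares hu]; rfl
      · exact .inr (.inr ⟨u, .inr hu, rfl⟩)
    · refine ⟨?_, Subgroup.subset_closure (.inr (.inr ⟨_, .inl rfl, rfl⟩))⟩
      rw [typ_odometer_sq]
      rfl

end LeafTyping

/-! ### The groups `M n` -/

/-- The action of `W n` on the left half of the leaves of the tree of height `n + 1`. -/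
def leftHalf (n : ℕ) : Equiv.Perm (Fin (2 ^ n)) →* Equiv.Perm (Fin (2 ^ (n + 1))) :=
  (wreath n).comp <| MonoidHom.mk' (fun g => ⟨fun | .s => g | .n => 1, 1⟩) fun g h => by
    refine RegularWreathProduct.ext (funext fun d => ?_) rfl
    cases d <;> rfl

theorem leftHalf_halves_s {n : ℕ} (g : Equiv.Perm (Fin (2 ^ n))) (i : Fin (2 ^ n)) :
    leftHalf n g (halves n (i, .s)) = halves n (g i, .s) := wreath_halves _ _ _

theorem leftHalf_halves_n {n : ℕ} (g : Equiv.Perm (Fin (2 ^ n))) (i : Fin (2 ^ n)) :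
    leftHalf n g (halves n (i, .n)) = halves n (i, .n) := wreath_halves _ _ _

theorem val_a {n j : ℕ} (hj : 1 ≤ j ∧ j ≤ n) (i : Fin (2 ^ n)) :
    (a n j i).val = swapHalves j i.val := by
  rw [a, dif_pos hj]
  rfl

theorem a_succ_self (n : ℕ) : a (n + 1) (n + 1) = wreath n ⟨1, .n⟩ := by
  ext l
  obtain ⟨⟨i, d⟩, rfl⟩ := (halves n).surjective l
  have hi := i.isLt
  rw [val_a (by omega), wreath_halves, swapHalves, Nat.add_sub_cancel]
  cases d
  · change _ = (halves n (i, .s)).val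
    rw [halves_val_n, halves_val_s, if_neg (by omega), if_pos (by omega), Nat.add_sub_cancel]
  · change _ = (halves n (i, .n)).val
    rw [halves_val_n, halves_val_s, if_pos hi]

theorem a_succ {n j : ℕ} (hj : j ≤ n) : a (n + 1) j = leftHalf n (a n j) := by
  obtain rfl | hpos := Nat.eq_zero_or_pos j
  · exact (map_one (leftHalf n)).symm
  ext l
  obtain ⟨⟨i, d⟩, rfl⟩ := (halves n).surjective l
  have hle : 2 ^ (j - 1) + 2 ^ (j - 1) ≤ 2 ^ n := by
    rw [← two_mul, ← pow_succ', Nat.sub_add_cancel hpos]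
    exact Nat.pow_le_pow_right two_pos hj
  rw [val_a ⟨hpos, by omega⟩]
  cases d
  · rw [leftHalf_halves_n, halves_val_n, swapHalves, if_neg (by omega), if_neg (by omega)]
  · rw [leftHalf_halves_s, halves_val_s, halves_val_s, val_a ⟨hpos, hj⟩]

theorem x_succ {n k : ℕ} (hk : k ≤ n) : x (n + 1) k = leftHalf n (x n k) := by
  induction k with
  | zero => exact (map_one (leftHalf n)).symm
  | succ k ih => rw [x, ih (by omega), a_succ hk, ← map_mul, x]

theorem x_one_sq (n : ℕ) : x n 1 ^ 2 = 1 := by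
  rw [x, x, one_mul, sq]
  ext i
  obtain hn | hn := Nat.lt_or_ge 0 n
  · rw [Equiv.Perm.mul_apply, val_a ⟨le_rfl, hn⟩, val_a ⟨le_rfl, hn⟩, swapHalves_swapHalves,
      Equiv.Perm.one_apply]
  · rw [a, dif_neg (by omega), one_mul]

namespace LeafTyping

variable {n : ℕ}

theorem perm_node_one (u : LeafTyping n) :
    perm (node u 1) = leftHalf n (perm u) * wreath n ⟨1, (typ u).2⟩ := by
  rw [leftHalf, MonoidHom.comp_apply, ← map_mul, perm_succ, swap_node_one]
  congr 1
  refine RegularWreathProduct.ext (funext fun d => ?_) rfl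
  cases d
  · exact (congrArg perm (sections_node_n u 1)).trans (map_one (permHom n))
  · exact congrArg perm (sections_node_s u 1)

theorem perm_node_one_of_typ_eq_one {u : LeafTyping n} (hu : typ u = 1) :
    perm (node u 1) = leftHalf n (perm u) := by
  rw [perm_node_one, hu]
  exact (congrArg (leftHalf n (perm u) * ·) (map_one (wreath n))).trans (mul_one _)

theorem perm_odometer (n : ℕ) : perm (odometer n) = x n n := by
  induction n with
  | zero => rfl
  | succ n ih =>
    rw [odometer, perm_node_one, ih, typ_odometer, x, x_succ le_rfl, a_succ_self]
    rfl

theorem perm_odometer_sq (n : ℕ) : perm (odometer n ^ 2) = x n n ^ 2 := by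
  rw [sq, perm_mul, perm_odometer, sq]

theorem image_perm_odometerSquares (n : ℕ) :
    perm '' odometerSquares n = (fun k => x n k ^ 2) '' Set.Iio n := by
  induction n with
  | zero => rw [odometerSquares, Set.image_empty, ← bot_eq_zero, Set.Iio_bot, Set.image_empty]
  | succ n ih =>
    have hperm : Set.EqOn (fun u => perm (node u 1)) (leftHalf n ∘ perm)
        (insert (odometer n ^ 2) (odometerSquares n)) := fun u hu =>
      perm_node_one_of_typ_eq_one <|
        hu.elim (fun h => h ▸ typ_odometer_sq n) typ_eq_one_of_mem_odometerSquares
    have hx : Set.EqOn (fun k => x (n + 1) k ^ 2) (leftHalf n ∘ fun k => x n k ^ 2)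
        (Set.Iic n) := fun k hk =>
      (congrArg (· ^ 2) (x_succ hk)).trans (map_pow (leftHalf n) _ 2).symm
    rw [odometerSquares, Set.image_image, hperm.image_eq, Set.image_comp, Set.image_insert_eq,
      perm_odometer_sq, ih, ← Set.image_insert_eq (f := fun k => x n k ^ 2), Set.Iio_insert,
      ← Set.image_comp, ← hx.image_eq, ← Order.Iio_succ]
    rfl

theorem exists_perm_eq_m {n : ℕ} (hn : 1 ≤ n) :
    ∃ g : LeafTyping n, perm g = m n ∧ digitProd n g = .n := by
  match n, hn with
  | 1, _ => exact ⟨node ⟨fun _ => ns⟩ 1, by decide, by decide⟩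
  | k + 2, _ =>
    refine ⟨(mTyped k).leafTyping, perm_leafTyping_mTyped k, ?_⟩
    rw [digitProd_apply, typ_leafTyping_mTyped]
    rfl

theorem range_permHom (hn : 1 ≤ n) : (permHom n).range = M n := by
  obtain ⟨g, hg, hdigit⟩ := exists_perm_eq_m hn
  have himage : permHom n '' insert g (insert (odometer n) (odometerSquares n)) =
      insert (m n) (insert (x n n) ((fun k => x n k ^ 2) '' Set.Iio n)) := by
    rw [← image_perm_odometerSquares, ← perm_odometer, ← hg, ← Set.image_insert_eq,
      ← Set.image_insert_eq]
    rfl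
  rw [MonoidHom.range_eq_map, ← closure_insert_odometers_eq_top hdigit, MonoidHom.map_closure,
    himage, M]
  refine le_antisymm ((Subgroup.closure_le _).mpr ?_) (Subgroup.closure_mono ?_)
  · refine Set.insert_subset (Subgroup.subset_closure (.inl (.inr rfl))) <| Set.insert_subset
      (Subgroup.subset_closure (.inl (.inl rfl))) ?_
    rintro _ ⟨k, hk, rfl⟩
    match k, hk with
    | 0, _ => exact one_mem _
    | 1, _ =>
      change x n 1 ^ 2 ∈ _
      rw [x_one_sq]
      exact one_mem _
    | k + 2, hk => exact Subgroup.subset_closure (.inr ⟨k, hk, rfl⟩)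
  · rintro _ ((rfl | rfl) | ⟨i, hi, rfl⟩)
    exacts [.inr (.inl rfl), .inl rfl, .inr (.inr ⟨i + 2, hi, rfl⟩)]

end LeafTyping

/-! ### Cycle types in the wreath product -/

section Wreath

open Function

variable {n : ℕ} (σ : Digit → Equiv.Perm (Fin (2 ^ n)))

theorem card_filter_halves (P : Fin (2 ^ (n + 1)) → Prop) [DecidablePred P] :
    ({l | P l} : Finset _).card = ({i | P (halves n (i, .s))} : Finset _).card +
      ({i | P (halves n (i, .n))} : Finset _).card := by
  simp only [Finset.card_filter, ← (halves n).sum_comp fun l => if P l then 1 else 0,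
    Fintype.sum_prod_type_right]
  exact (Finset.sum_pair (by decide)).trans (add_comm _ _)

theorem halves_injective (d : Digit) : Injective fun i => halves n (i, d) :=
  (halves n).injective.comp (Prod.mk_left_injective d)

theorem parts_wreath_s : (wreath n ⟨σ, .s⟩).partition.parts =
    (σ .s).partition.parts + (σ .n).partition.parts := by
  refine parts_eq_of_card_filter_minimalPeriod ?_ fun d => ?_
  · rw [Multiset.mem_add, not_or]
    exact ⟨zero_notMem_parts _, zero_notMem_parts _⟩
  · have hperiod (e : Digit) (i : Fin (2 ^ n)) :
        minimalPeriod (wreath n ⟨σ, .s⟩) (halves n (i, e)) = minimalPeriod (σ e) i :=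
      minimalPeriod_of_semiconj (halves_injective e)
        (fun i => ((wreath_halves ⟨σ, .s⟩ i e).trans (by cases e <;> rfl)).symm) i
    rw [card_filter_halves]
    simp only [hperiod, card_filter_minimalPeriod_eq, Multiset.count_add, mul_add]

theorem minimalPeriod_wreath_n (i : Fin (2 ^ n)) (d : Digit) :
    minimalPeriod (wreath n ⟨σ, .n⟩) (halves n (i, d)) =
      2 * minimalPeriod (σ d * σ (.n * d)) i := by
  have hsnd : Semiconj (fun l => ((halves n).symm l).2) (wreath n ⟨σ, .n⟩) (Digit.n * ·) := by
    intro l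
    obtain ⟨⟨j, e⟩, rfl⟩ := (halves n).surjective l
    simp only [wreath_halves, Equiv.symm_apply_apply]
  have hflip (e : Digit) : minimalPeriod (Digit.n * ·) e = 2 :=
    minimalPeriod_eq_prime (by revert e; decide) (by revert e; decide)
  refine minimalPeriod_of_semiconj_iterate_two (halves_injective d) (fun j => ?_) ?_
  · change _ = wreath n ⟨σ, .n⟩ (wreath n ⟨σ, .n⟩ (halves n (j, d)))
    rw [wreath_halves, wreath_halves, Digit.mul_mul_cancel]
    rfl
  · have hmap := (isPeriodicPt_minimalPeriod (wreath n ⟨σ, .n⟩) (halves n (i, d))).map hsnd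
    exact (hflip _).symm.dvd.trans hmap.minimalPeriod_dvd

theorem parts_wreath_n : (wreath n ⟨σ, .n⟩).partition.parts =
    (σ .s * σ .n).partition.parts.map (2 * ·) := by
  refine parts_eq_of_card_filter_minimalPeriod ?_ fun d => ?_
  · rw [Multiset.mem_map]
    rintro ⟨k, hk, hzero⟩
    exact zero_notMem_parts _ ((mul_eq_zero.mp hzero).resolve_left two_ne_zero ▸ hk)
  · have hconj : (σ .n * σ .s).partition = (σ .s * σ .n).partition :=
      Equiv.Perm.partition_eq_of_isConj.mp (isConj_iff.mpr ⟨σ .s, by group⟩)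
    have hs := card_filter_mul_minimalPeriod_eq (σ .s * σ .n) two_pos d
    have hn := card_filter_mul_minimalPeriod_eq (σ .n * σ .s) two_pos d
    rw [hconj] at hn
    rw [card_filter_halves]
    simp only [minimalPeriod_wreath_n, Digit.mul_self, show Digit.n * .s = .n from rfl]
    linarith

end Wreath

/-! ### The Markov process as an algebra homomorphism -/

/-- Finite formal sums of multisets of degrees, with the same operations as `Data`; the cycle data
of the model and of a group of permutations are compared here. -/
abbrev CycleData : Type := AddMonoidAlgebra ℚ (Multiset ℕ)

/-- `step` as an algebra homomorphism: it is multiplicative because the factors have their children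
independently. -/
noncomputable def stepHom : Data →ₐ[ℚ] Data :=
  AddMonoidAlgebra.lift ℚ Data FactType
    { toFun := fun F => (F.toAdd.map children).prod
      map_one' := Multiset.prod_zero
      map_mul' := fun _ _ => (congrArg Multiset.prod (Multiset.map_add _ _ _)).trans
        (Multiset.prod_add _ _) }

theorem stepHom_apply (D : Data) : stepHom D = step D := AddMonoidAlgebra.lift_apply _ _

theorem stepHom_datum_singleton (p : Typ × ℕ) : stepHom (datum {p} 1) = children p := by
  rw [stepHom, datum, AddMonoidAlgebra.lift_single, one_smul]
  exact Multiset.prod_singleton (children p)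

/-- The cycle data after `n` steps of the Markov process. -/
noncomputable def cycleDataHom : ℕ → Data →ₐ[ℚ] CycleData
  | 0 => AddMonoidAlgebra.mapDomainAlgHom ℚ ℚ (Multiset.mapAddMonoidHom Prod.snd)
  | n + 1 => (cycleDataHom n).comp stepHom

theorem cycleDataHom_coeff (n : ℕ) (D : Data) :
    (cycleDataHom n D).coeff = (step^[n] D).coeff.mapDomain (Multiset.map Prod.snd) := by
  induction n generalizing D with
  | zero => rfl
  | succ n ih =>
    rw [Function.iterate_succ_apply, ← ih, ← stepHom_apply]
    rfl

theorem modelCycleData_succ (D : Data) (n : ℕ) :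
    modelCycleData D (n + 1) = (cycleDataHom n D).coeff :=
  (cycleDataHom_coeff n D).symm

theorem cycleDataHom_zero_datum_singleton (T : Typ) (d : ℕ) :
    cycleDataHom 0 (datum {(T, d)} 1) = AddMonoidAlgebra.single {d} 1 :=
  AddMonoidAlgebra.mapDomain_single

theorem cycleDataHom_succ_datum_singleton (n : ℕ) (p : Typ × ℕ) :
    cycleDataHom (n + 1) (datum {p} 1) = cycleDataHom n (children p) :=
  congrArg (cycleDataHom n) (stepHom_datum_singleton p)

theorem datum_pair (p q : Typ × ℕ) : datum {p, q} 1 = datum {p} 1 * datum {q} 1 := by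
  rw [datum, datum, datum, AddMonoidAlgebra.single_mul_single, mul_one]
  rfl

theorem smul_datum (r t : ℚ) (F : FactType) : r • datum F t = datum F (r * t) :=
  AddMonoidAlgebra.smul_single' _ _ _

theorem datum_add (F : FactType) (r t : ℚ) : datum F (r + t) = datum F r + datum F t :=
  AddMonoidAlgebra.single_add _ _ _

theorem children_of_n {T : Typ} (hT : T.1 = .n) (d : ℕ) :
    children (T, d) = datum {(T.shift, 2 * d)} 1 := by
  simp only [children, hT]

theorem card_allowable {T : Typ} (hT : T.1 = .s) : (allowable T).card = 4 := by
  revert T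
  decide

theorem mem_allowable {T : Typ} (hT : T.1 = .s) (q : Typ × Typ) :
    q ∈ allowable T ↔ (q.1 * q.2).shift = T := by
  revert T q
  decide

theorem children_of_s {T : Typ} (hT : T.1 = .s) (d : ℕ) :
    children (T, d) = ∑ q ∈ allowable T, datum {(q.1, d), (q.2, d)} (1 / 4) := by
  simp only [children, hT, card_allowable hT]
  rfl

theorem children_sn (d : ℕ) : children (sn, d) =
    datum {(nn, d), (sn, d)} (1 / 2) + datum {(ns, d), (ss, d)} (1 / 2) := by
  have hpairs : allowable sn = {(nn, sn), (sn, nn), (ns, ss), (ss, ns)} := by decide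
  rw [children_of_s rfl, hpairs, Finset.sum_insert (by decide), Finset.sum_insert (by decide),
    Finset.sum_pair (by decide), Multiset.pair_comm (sn, d), Multiset.pair_comm (ss, d),
    ← add_assoc, ← datum_add, ← datum_add]
  norm_num

theorem children_ss (d : ℕ) : children (ss, d) =
    ∑ T : Typ, datum {(T, d), (T, d)} (1 / 4) := by
  have hdiag : allowable ss =
      Finset.univ.map ⟨fun T => (T, T), fun _ _ h => congrArg Prod.fst h⟩ := by
    decide
  rw [children_of_s rfl, hdiag, Finset.sum_map]
  rfl

theorem sum_typ {R : Type*} [AddCommMonoid R] (f : Typ → R) :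
    ∑ T, f T = f nn + f ns + f sn + f ss := by
  have huniv : (Finset.univ : Finset Typ) = {nn, ns, sn, ss} := by decide
  rw [huniv, Finset.sum_insert (by decide), Finset.sum_insert (by decide),
    Finset.sum_pair (by decide), add_assoc, add_assoc]

theorem model5_eq_stepHom : model5 = stepHom (∑ T : Typ, (1 / 4 : ℚ) • datum {(T, 1)} 1) := by
  simp only [map_sum, map_smul, stepHom_datum_singleton]
  have hnn : children (nn, 1) = datum {(nn, 2)} 1 := children_of_n rfl 1
  have hns : children (ns, 1) = datum {(sn, 2)} 1 := children_of_n rfl 1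
  rw [sum_typ, hnn, hns, children_sn, children_ss, sum_typ]
  simp only [smul_add, smul_datum, model5]
  norm_num
  abel

/-! ### The cycle data of the leaf typings -/

namespace LeafTyping

variable {n : ℕ}

theorem parts_perm_of_swap_eq_n {g : LeafTyping (n + 1)} (hg : swap g = .n) :
    (perm g).partition.parts =
      (perm (sections g .s * sections g .n)).partition.parts.map (2 * ·) := by
  rw [perm_succ, hg, parts_wreath_n, perm_mul]

theorem parts_perm_of_swap_eq_s {g : LeafTyping (n + 1)} (hg : swap g = .s) :
    (perm g).partition.parts =
      (perm (sections g .s)).partition.parts + (perm (sections g .n)).partition.parts := by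
  rw [perm_succ, hg, parts_wreath_s]

/-- The cycle type of an element with all lengths multiplied by `d`, as a formal monomial. -/
noncomputable def cycleMonomial (g : LeafTyping n) (d : ℕ) : CycleData :=
  AddMonoidAlgebra.single ((perm g).partition.parts.map (d * ·)) 1

theorem cycleMonomial_of_swap_eq_n {g : LeafTyping (n + 1)} (hg : swap g = .n) (d : ℕ) :
    cycleMonomial g d = cycleMonomial (sections g .s * sections g .n) (2 * d) := by
  rw [cycleMonomial, cycleMonomial, parts_perm_of_swap_eq_n hg, Multiset.map_map]
  simp only [Function.comp_apply, mul_left_comm d, mul_assoc]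

theorem cycleMonomial_of_swap_eq_s {g : LeafTyping (n + 1)} (hg : swap g = .s) (d : ℕ) :
    cycleMonomial g d = cycleMonomial (sections g .s) d * cycleMonomial (sections g .n) d := by
  rw [cycleMonomial, cycleMonomial, cycleMonomial, AddMonoidAlgebra.single_mul_single,
    parts_perm_of_swap_eq_s hg, Multiset.map_add, mul_one]

/-- The sum of the monomials of the elements of type `T`. -/
noncomputable def cycleSum (n : ℕ) (T : Typ) (d : ℕ) : CycleData :=
  ∑ g : LeafTyping n with typ g = T, cycleMonomial g d

theorem cycleSum_succ_of_n {T : Typ} (hT : T.1 = .n) (d : ℕ) :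
    cycleSum (n + 1) T d = (Fintype.card (LeafTyping n) : ℚ) • cycleSum n T.shift (2 * d) := by
  have hpairs : cycleSum (n + 1) T d =
      ∑ p ∈ (Finset.univ : Finset (LeafTyping n)) ×ˢ
          ({h | typ h = T.shift} : Finset (LeafTyping n)),
        cycleMonomial p.2 (2 * d) := by
    refine Finset.sum_nbij' (fun g => (sections g .n, sections g .s * sections g .n))
      (fun p => node (p.2 * p.1⁻¹) p.1) ?_ ?_ ?_ ?_ ?_
    · intro g hg
      obtain rfl := (Finset.mem_filter.mp hg).2
      simp only [Finset.mem_product, Finset.mem_filter, Finset.mem_univ, true_and,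
        typ_mul, typ_succ]
      rfl
    · intro p hp
      have htyp : typ p.2 = T.shift := (Finset.mem_filter.mp (Finset.mem_product.mp hp).2).2
      rw [Finset.mem_filter, typ_node, ← typ_mul, inv_mul_cancel_right, htyp]
      exact ⟨Finset.mem_univ _, rfl⟩
    · intro g _
      rw [mul_inv_cancel_right, node_sections]
    · intro p _
      rw [sections_node_s, sections_node_n, inv_mul_cancel_right]
    · intro g hg
      exact cycleMonomial_of_swap_eq_n ((congrArg Prod.fst (Finset.mem_filter.mp hg).2).trans hT) d
  rw [Nat.cast_smul_eq_nsmul, ← Finset.card_univ, ← Finset.sum_const, hpairs, Finset.sum_product]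
  rfl

theorem cycleSum_succ_of_s {T : Typ} (hT : T.1 = .s) (d : ℕ) :
    cycleSum (n + 1) T d = ∑ q ∈ allowable T, cycleSum n q.1 d * cycleSum n q.2 d := by
  have hmaps (g : LeafTyping (n + 1)) (hg : g ∈ ({g | typ g = T} : Finset (LeafTyping (n + 1)))) :
      (typ (sections g .s), typ (sections g .n)) ∈ allowable T := by
    rw [mem_allowable hT, ← typ_succ]
    exact (Finset.mem_filter.mp hg).2
  rw [cycleSum, ← Finset.sum_fiberwise_of_maps_to hmaps]
  refine Finset.sum_congr rfl fun q hq => ?_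
  rw [cycleSum, cycleSum, Finset.sum_mul_sum, ← Finset.sum_product']
  refine Finset.sum_nbij' (fun g => (sections g .s, sections g .n))
    (fun p => node p.1 p.2) ?_ ?_ ?_ ?_ ?_
  · intro g hg
    obtain rfl := (Finset.mem_filter.mp hg).2
    simp only [Finset.mem_product, Finset.mem_filter, Finset.mem_univ, and_self]
  · intro p hp
    obtain ⟨hs, hn⟩ := Finset.mem_product.mp hp
    have hpair : (typ p.1, typ p.2) = q :=
      Prod.ext (Finset.mem_filter.mp hs).2 (Finset.mem_filter.mp hn).2
    simp only [Finset.mem_filter, Finset.mem_univ, true_and, typ_node, sections_node_s,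
      sections_node_n, hpair, and_true]
    rw [← (mem_allowable hT q).mp hq, ← hpair]
  · intro g _
    exact node_sections g
  · intro p _
    exact Prod.ext (sections_node_s _ _) (sections_node_n _ _)
  · intro g hg
    have htyp : typ g = T := (Finset.mem_filter.mp (Finset.mem_filter.mp hg).1).2
    exact cycleMonomial_of_swap_eq_s ((congrArg Prod.fst htyp).trans hT) d

theorem card_succ (n : ℕ) :
    Fintype.card (LeafTyping (n + 1)) = Fintype.card (LeafTyping n) ^ 2 := by
  rw [card_eq, card_eq, pow_succ 2, pow_mul]

theorem typ_zero (g : LeafTyping 0) : typ g = g.label 0 := Fin.prod_univ_one g.label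

theorem parts_perm_zero (g : LeafTyping 0) : (perm g).partition.parts = {1} := by
  have hperm : perm g = 1 := rfl
  rw [hperm, Equiv.Perm.parts_partition, Equiv.Perm.cycleType_one, Equiv.Perm.support_one,
    Fintype.card_fin]
  rfl

theorem cycleSum_zero (T : Typ) (d : ℕ) : cycleSum 0 T d = AddMonoidAlgebra.single {d} 1 := by
  have hfilter : ({g | typ g = T} : Finset (LeafTyping 0)) = {⟨fun _ => T⟩} := by
    ext g
    rw [Finset.mem_filter_univ, Finset.mem_singleton, LeafTyping.ext_iff, typ_zero, funext_iff]
    exact (Fin.forall_fin_one (p := fun i => g.label i = T)).symm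
  rw [cycleSum, hfilter, Finset.sum_singleton, cycleMonomial, parts_perm_zero,
    Multiset.map_singleton, mul_one]

theorem cycleSum_eq (n : ℕ) (T : Typ) (d : ℕ) : cycleSum n T d =
    (Fintype.card (LeafTyping n) / 4 : ℚ) • cycleDataHom n (datum {(T, d)} 1) := by
  induction n generalizing T d with
  | zero =>
    rw [cycleSum_zero, cycleDataHom_zero_datum_singleton, card_eq]
    norm_num
  | succ n ih =>
    rw [cycleDataHom_succ_datum_singleton, card_succ]
    cases hT : T.1 with
    | n =>
      rw [cycleSum_succ_of_n hT, ih, smul_smul, children_of_n hT]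
      push_cast
      ring_nf
    | s =>
      rw [cycleSum_succ_of_s hT, children_of_s hT, map_sum, Finset.smul_sum]
      refine Finset.sum_congr rfl fun q _ => ?_
      rw [ih, ih, smul_mul_smul_comm, ← map_mul, ← datum_pair, ← mul_one (1 / 4), ← smul_datum,
        map_smul, smul_smul]
      push_cast
      ring_nf

theorem sum_cycleMonomial (n : ℕ) : ∑ g : LeafTyping (n + 1), cycleMonomial g 1 =
    (Fintype.card (LeafTyping (n + 1)) : ℚ) • cycleDataHom n model5 := by
  rw [← Finset.sum_fiberwise _ typ, model5_eq_stepHom, ← AlgHom.comp_apply, ← cycleDataHom, map_sum,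
    Finset.smul_sum]
  refine Finset.sum_congr rfl fun T _ => ?_
  rw [← cycleSum, cycleSum_eq, map_smul, smul_smul, mul_one_div]

theorem card_parts_eq (n : ℕ) (c : Multiset ℕ) :
    (Nat.card {g : LeafTyping (n + 1) // (perm g).partition.parts = c} : ℚ) =
      Nat.card (LeafTyping (n + 1)) * modelCycleData model5 (n + 1) c := by
  have hcoeff := congrArg (fun D : CycleData => D.coeff c) (sum_cycleMonomial n)
  rw [modelCycleData_succ, Nat.card_eq_fintype_card, Nat.card_eq_fintype_card]
  refine Eq.trans ?_ hcoeff
  rw [Fintype.card_subtype, Finset.card_filter]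
  simp [cycleMonomial, Finsupp.single_apply, AddMonoidAlgebra.coeff_sum, Finsupp.finsetSum_apply]

end LeafTyping

theorem cycleProportion_range_permHom (n : ℕ) (c : Multiset ℕ) :
    cycleProportion (LeafTyping.permHom n).range c =
      (Nat.card {g : LeafTyping n // (LeafTyping.perm g).partition.parts = c} : ℚ) /
        Nat.card (LeafTyping n) :=
  (card_subtype_comp_div_card (LeafTyping.permHom n).rangeRestrict_surjective
    fun h => (h : Equiv.Perm (Fin (2 ^ n))).partition.parts = c).symm

end PCFMarkov

theorem theoremC (n : ℕ) (hn : 1 ≤ n) :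
    PCFMarkov.Satisfies PCFMarkov.model5 n (PCFMarkov.M n) := by
  rw [← PCFMarkov.LeafTyping.range_permHom hn]
  refine ⟨?_, fun c => ?_⟩
  · rintro _ ⟨g, rfl⟩
    exact PCFMarkov.LeafTyping.perm_mem_treeAut g
  · obtain ⟨k, rfl⟩ := Nat.exists_eq_add_of_le' hn
    rw [PCFMarkov.cycleProportion_range_permHom, PCFMarkov.LeafTyping.card_parts_eq,
      mul_div_cancel_left₀]
    exact Nat.cast_ne_zero.mpr Nat.card_pos.ne'
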